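/- All graphs are finite, simple, loopless and undirected. For a graph $G$, an integer $r\ge 0$, a set $A\subseteq V(G)$ and a vertex $v$, the $r$-profile of $v$ with respect to $A$ is the function on $A$ that maps $a\in A$ to the distance $\mathrm{dist}_G(a,v)$ if this is at most $r$, and to $+\infty$ otherwise. Let $\mathrm{pc}_r(G,A)$ be the number of distinct $r$-profiles of vertices of $G$ with respect to $A$, not counting the profile that is constantly $+\infty$, and let $\mathrm{pc}_r(G,k)$ be the maximum of $\mathrm{pc}_r(G,A)$ over all $A\subseteq V(G)$ with $|A|=k$ (and $0$ if $k>|V(G)|$). A tree representation of $G$ is a finite tree $T$ with a (nonempty) subtree $T_v$ of $T$ for every $v\in V(G)$, such that $T_u$ and $T_v$ share a node whenever $uv\in E(G)$; its width is $\max_{x\in V(T)}|\{v\in V(G) : x\in V(T_v)\}|-1$, and the treewidth of $G$ is the minimum width of a tree representation of $G$. **Theorem.** If $G$ has treewidth at most $t$, where $t\geq 0$ is an integer, then for every integer $r\ge 0$ and every $A\subseteq V(G)$, $$\mathrm{pc}_r(G,A)\le 2^{t+3}(r+1)^{t+1}(t+1)^{t+1}\,|A|.$$ Moreover $\mathrm{pc}_r(G,k)\in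 O(t^{O(t)}r^{t+1}k)$ for positive integers $t,r$; that is, there are absolute constants $c,C$ such that for all integers $t,r\ge 1$ and $k\ge 0$ and every graph $G$ of treewidth at most $t$, $$\mathrm{pc}_r(G,k)\le C\,t^{ct}\,r^{t+1}\,k .$$ -/

import Mathlib

universe u

namespace ProfileComplexity

noncomputable section

/-- The truncation of a distance: `cap r l = l` if `l ≤ r`, and `cap r l = +∞` otherwise. -/
def cap (r : ℕ) (l : ℕ∞) : ℕ∞ := if l ≤ (r : ℕ∞) then l else ⊤

/-- The `r`-profile of `v` with respect to `A`: the function `a ↦ cap r (dist (a, v))` on `A`.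
The distance is `+∞` between vertices of different components. -/
def profile {V : Type u} (G : SimpleGraph V) (r : ℕ) (A : Finset V) (v : V) : A → ℕ∞ :=
  fun a => cap r (G.edist a.1 v)

/-- `pc_r(G, A)`: the number of different `r`-profiles with respect to `A`, not counting
the profile that is constantly `+∞`. -/
def pcOn {V : Type u} [Fintype V] (G : SimpleGraph V) (r : ℕ) (A : Finset V) : ℕ :=
  (Set.range (profile G r A) \ {fun _ => ⊤}).ncard

/-- The `r`-profile complexity `pc_r(G, k)`: the maximum of `pc_r(G, A)` over all sets `A` of
exactly `k` vertices (and `0` if `G` has fewer than `k` vertices). -/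
def pc {V : Type u} [Fintype V] (G : SimpleGraph V) (r k : ℕ) : ℕ :=
  ((Finset.univ : Finset V).powersetCard k).sup (pcOn G r)

/-- A tree representation of `G`: a finite tree together with a subtree, the model, for every
vertex of `G`, such that the models of adjacent vertices share a node. -/
structure TreeRepresentation {V : Type u} (G : SimpleGraph V) where
  /-- the nodes of the tree -/
  Node : Type
  finite_node : Finite Node
  /-- the tree -/
  tree : SimpleGraph Node
  isTree : tree.IsTree
  /-- the model of a vertex -/
  model : V → tree.Subgraph
  model_isTree : ∀ v, (model v).coe.IsTree
  model_inter : ∀ u v, G.Adj u v → ((model u).verts ∩ (model v).verts).Nonempty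

/-- The bag at a node `x`: the set of all vertices whose model contains `x`. -/
def TreeRepresentation.bag {V : Type u} {G : SimpleGraph V} (R : TreeRepresentation G)
    (x : R.Node) : Set V := {v | x ∈ (R.model v).verts}

/-- The width of a tree representation: the maximum size of a bag, minus one. -/
def TreeRepresentation.width {V : Type u} [Fintype V] {G : SimpleGraph V}
    (R : TreeRepresentation G) : ℤ := ((⨆ x : R.Node, (R.bag x).ncard : ℕ) : ℤ) - 1

/-- The treewidth of a finite graph: the minimum width of a tree representation. (It is `-1` for
the graph without vertices.) -/
def treewidth {V : Type u} [Fintype V] (G : SimpleGraph V) : ℤ :=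
  sInf (Set.range (TreeRepresentation.width (G := G)))

/-- The representation with a single node, whose bag is the whole vertex set. -/
def trivialRepresentation {V : Type u} (G : SimpleGraph V) : TreeRepresentation G where
  Node := Unit
  finite_node := inferInstance
  tree := ⊥
  isTree := SimpleGraph.IsTree.of_subsingleton
  model := fun _ => ⊤
  model_isTree := fun _ =>
    haveI : Nonempty (⊤ : (⊥ : SimpleGraph Unit).Subgraph).verts := ⟨⟨(), trivial⟩⟩
    SimpleGraph.IsTree.of_subsingleton
  model_inter := fun _ _ _ => ⟨(), trivial, trivial⟩

/-- The minimum in the definition of the treewidth is attained. -/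
theorem exists_width_eq_treewidth {V : Type u} [Fintype V] (G : SimpleGraph V) :
    ∃ R : TreeRepresentation G, R.width = treewidth G := by
  have h1 : (Set.range (TreeRepresentation.width (G := G))).Nonempty :=
    ⟨_, trivialRepresentation G, rfl⟩
  have h2 : BddBelow (Set.range (TreeRepresentation.width (G := G))) := by
    refine ⟨-1, ?_⟩
    rintro _ ⟨R, rfl⟩
    unfold TreeRepresentation.width
    omega
  exact Int.csInf_mem h1 h2

end

end ProfileComplexity

/-!
A nonempty set `A` of vertices is cut off from the rest of the graph by few bags. Choose a node in
the model of every `a ∈ A`. Every node of the tree is separated from the at most `#A` chosen nodes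
by a pair of nodes, and `2 * #A` pairs suffice for this (`exists_separating_pairs`): once the tree
is rooted, the pairs are indexed by the nonempty sets of chosen nodes that lie below some node, and
these sets form a laminar family (`card_le_of_laminar`). The unions `B` of the two bags of these
pairs have at most `2 * (t + 1)` vertices, and every vertex `v` is separated from `A` by one of
them, so that the `r`-profile of `v` with respect to `A` is determined by `B` and the `r`-profile
with respect to `B` (`cap_edist_eq`).

Counting profiles with respect to `B` naively would give an exponent `2 * (t + 1)` of `r + 1`. To
halve it, a profile is encoded as the set of pairs `(b, i)`, with `b ∈ B` and `i ≤ r`, such that the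
ball of radius `i` around `b` contains `v`. The family of these sets has Vapnik-Chervonenkis
dimension at most `t + 1`: if it shatters a set of balls, then the cells of the additively weighted
Voronoi diagram of these balls are disjoint, connected and pairwise adjacent
(`TreeRepresentation.card_le_of_realized`), and by the Helly property of subtrees they all meet one
bag (`TreeRepresentation.card_le_of_pairwise_adj`). With `n = 2 * (t + 1) * (r + 1)` pairs, the
Sauer-Shelah lemma yields at most `2 * n ^ (t + 1)` profiles with respect to `B`, and altogether at
most `2 * #A * (2 * n ^ (t + 1))` profiles with respect to `A`.
-/

namespace ProfileComplexity

open SimpleGraph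

/-! ### Ancestors in a rooted tree -/

section Tree

variable {N : Type*} {T : SimpleGraph N} {ρ u v w z s : N}

/-- `Anc T ρ u v`: in the tree `T` with root `ρ`, the node `u` is an ancestor of `v` (possibly `v`
itself). This is encoded by `u` lying on a shortest path from the root to `v`. -/
def Anc (T : SimpleGraph N) (ρ u v : N) : Prop := T.dist ρ u + T.dist u v = T.dist ρ v

theorem Anc.refl (T : SimpleGraph N) (ρ u : N) : Anc T ρ u u := by simp [Anc]

theorem Anc.root (T : SimpleGraph N) (ρ u : N) : Anc T ρ ρ u := by simp [Anc]

theorem Anc.trans (hT : T.Connected) (h1 : Anc T ρ u v) (h2 : Anc T ρ v w) : Anc T ρ u w := by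
  unfold Anc at *
  have := hT.dist_triangle (u := u) (v := v) (w := w)
  have := hT.dist_triangle (u := ρ) (v := u) (w := w)
  omega

theorem Anc.dist_root_le (h : Anc T ρ u v) : T.dist ρ u ≤ T.dist ρ v := by
  unfold Anc at h; omega

theorem Anc.eq_of_dist_le (hT : T.Connected) (h : Anc T ρ u v) (h' : T.dist ρ v ≤ T.dist ρ u) :
    u = v := by
  unfold Anc at h
  exact hT.dist_eq_zero_iff.1 (by omega)

theorem anc_of_adj (h : T.Adj u v) (h' : T.dist ρ v = T.dist ρ u + 1) : Anc T ρ u v := by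
  unfold Anc; rw [dist_eq_one_iff_adj.2 h, h']

theorem exists_shortest_path_concat (hT : T.Connected) (h : T.Adj u v)
    (h' : T.dist ρ v = T.dist ρ u + 1) :
    ∃ p : T.Walk ρ v, p.IsPath ∧ p.penultimate = u := by
  obtain ⟨p, hp⟩ := hT.exists_walk_length_eq_dist ρ u
  refine ⟨p.concat h, Walk.isPath_of_length_eq_dist _ ?_, Walk.penultimate_concat _ _⟩
  rw [Walk.length_concat, hp, h']

/-- In a rooted tree every node has at most one parent. -/
theorem parent_unique (hT : T.IsTree) (hu : T.Adj u v) (hu' : T.dist ρ v = T.dist ρ u + 1)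
    (hw : T.Adj w v) (hw' : T.dist ρ v = T.dist ρ w + 1) : u = w := by
  obtain ⟨p, hp, rfl⟩ := exists_shortest_path_concat hT.connected hu hu'
  obtain ⟨q, hq, rfl⟩ := exists_shortest_path_concat hT.connected hw hw'
  rw [(hT.existsUnique_path ρ v).unique hp hq]

/-- An ancestor of `v` other than `v` is an ancestor of the parent of `v`. -/
theorem Anc.parent (hT : T.IsTree) (h : Anc T ρ u v) (hne : u ≠ v) (hw : T.Adj w v)
    (hw' : T.dist ρ v = T.dist ρ w + 1) : Anc T ρ u w := by
  obtain ⟨p, hp⟩ := hT.connected.exists_walk_length_eq_dist u v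
  have hnil : ¬ p.Nil := fun h => hne h.eq
  have hadj := p.adj_penultimate hnil
  have h1 : T.dist u p.penultimate + 1 ≤ T.dist u v := by
    have := dist_le p.dropLast
    have h3 := Walk.length_dropLast_add_one hnil
    omega
  have h2 := hT.connected.dist_triangle (u := ρ) (v := u) (w := p.penultimate)
  have h3 := hT.connected.dist_triangle (u := ρ) (v := p.penultimate) (w := v)
  rw [dist_eq_one_iff_adj.2 hadj] at h3
  unfold Anc at *
  have := parent_unique hT (ρ := ρ) hw hw' hadj (by omega)
  rw [this]
  omega

/-- The ancestors of a node form a chain. -/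
theorem Anc.total (hT : T.IsTree) (h1 : Anc T ρ u s) (h2 : Anc T ρ w s) :
    Anc T ρ u w ∨ Anc T ρ w u := by
  induction hn : T.dist ρ s generalizing s with
  | zero =>
    have e1 := h1.eq_of_dist_le hT.connected (by omega)
    subst e1
    exact Or.inr h2
  | succ n ih =>
    by_cases e1 : u = s
    · subst e1; exact Or.inr h2
    by_cases e2 : w = s
    · subst e2; exact Or.inl h1
    have hne : s ≠ ρ := by rintro rfl; simp at hn
    obtain ⟨p, hp⟩ := hT.connected.exists_walk_length_eq_dist ρ s
    have hnil : ¬ p.Nil := fun h => hne h.eq.symm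
    have hadj := p.adj_penultimate hnil
    have h4 : T.dist ρ s = T.dist ρ p.penultimate + 1 := by
      have h5 := dist_le p.dropLast
      have h3 := Walk.length_dropLast_add_one hnil
      rcases hT.dist_eq_dist_add_one_of_adj ρ hadj with h | h <;> omega
    exact ih (h1.parent hT e1 hadj h4) (h2.parent hT e2 hadj h4) (by omega)

/-- Every walk in a rooted tree passes through a common ancestor `m` of its ends, and through all
nodes between `m` and either end. -/
theorem exists_anc_of_walk (hT : T.IsTree) (ρ : N) (p : T.Walk z s) :
    ∃ m, Anc T ρ m z ∧ Anc T ρ m s ∧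
      ∀ u, Anc T ρ m u → (Anc T ρ u z ∨ Anc T ρ u s) → u ∈ p.support := by
  induction p with
  | nil =>
    rename_i a
    refine ⟨a, Anc.refl _ _ _, Anc.refl _ _ _, fun u h1 h2 => ?_⟩
    rw [or_self] at h2
    simp [h1.eq_of_dist_le hT.connected h2.dist_root_le]
  | cons hadj p ih =>
    rename_i a b c
    obtain ⟨m, hmb, hmc, hm⟩ := ih
    rcases hT.dist_eq_dist_add_one_of_adj ρ hadj with h | h
    · -- `b` is the parent of `a`, and `m` still works
      have hba := anc_of_adj hadj.symm h
      refine ⟨m, hmb.trans hT.connected hba, hmc, fun u h1 h2 => ?_⟩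
      rw [Walk.support_cons, List.mem_cons]
      by_cases hu : u = a
      · exact Or.inl hu
      · exact Or.inr (hm u h1 (h2.imp_left fun h3 => h3.parent hT hu hadj.symm h))
    · -- `a` is the parent of `b`; if `m = b`, then `a` has to take its place
      have hab := anc_of_adj hadj h
      by_cases hmb' : m = b
      · subst hmb'
        refine ⟨a, Anc.refl _ _ _, hab.trans hT.connected hmc, fun u h1 h2 => ?_⟩
        rw [Walk.support_cons, List.mem_cons]
        rcases h2 with h2 | h2
        · exact Or.inl (h2.eq_of_dist_le hT.connected h1.dist_root_le)
        · rcases h2.total hT hmc with h3 | h3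
          · by_cases hu : u = m
            · subst hu; exact Or.inr (hm u hmb (Or.inl hmb))
            · exact Or.inl ((h3.parent hT hu hadj h).eq_of_dist_le hT.connected h1.dist_root_le)
          · exact Or.inr (hm u h3 (Or.inr h2))
      · refine ⟨m, hmb.parent hT hmb' hadj h, hmc, fun u h1 h2 => ?_⟩
        rw [Walk.support_cons, List.mem_cons]
        exact Or.inr (hm u h1 (h2.imp_left fun h3 => h3.trans hT.connected hab))

end Tree

/-! ### Separating a node of a tree from a set of nodes -/

section Laminar

variable {α : Type*} [DecidableEq α]

/-- A laminar family of nonempty subsets of `S` has at most `2 * #S` members. Deleting a point `s`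
from all members costs at most two of them: `{s}` vanishes, and only one pair
`M`, `insert s M` of members with `M` nonempty can be merged. -/
theorem card_le_of_laminar (S : Finset α) (F : Finset (Finset α)) (hsub : ∀ L ∈ F, L ⊆ S)
    (hne : ∀ L ∈ F, L.Nonempty)
    (hlam : ∀ L ∈ F, ∀ M ∈ F, L ⊆ M ∨ M ⊆ L ∨ Disjoint L M) : F.card ≤ 2 * S.card := by
  induction S using Finset.induction_on generalizing F with
  | empty =>
    have : F = ∅ := Finset.eq_empty_of_forall_notMem fun L hL =>
      (hne L hL).ne_empty (Finset.subset_empty.1 (hsub L hL))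
    simp [this]
  | insert s S hs ih =>
    have hF' := ih ((F.image (·.erase s)).erase ∅) ?_ ?_ ?_
    · -- the members that may get lost: deleting `s` empties them or turns them into another member
      set F2 := F.filter fun L => s ∈ L ∧ (L.erase s = ∅ ∨ L.erase s ∈ F) with hF2
      have h2 : (F2.erase {s}).card ≤ 1 := by
        have key : ∀ L ∈ F2.erase {s}, ∀ M ∈ F2.erase {s}, L ⊆ M → L = M := by
          intro L hL M hM hLM
          simp only [hF2, Finset.mem_erase, Finset.mem_filter] at hL hM
          obtain ⟨hL1, hL2, hL3, -⟩ := hL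
          obtain ⟨hM1, hM2, hM3, hM4⟩ := hM
          have hM5 : M.erase s ∈ F := hM4.resolve_left fun h => by
            rw [Finset.erase_eq_empty_iff] at h
            rcases h with h | h
            · simp [h] at hM3
            · exact hM1 h
          rcases hlam L hL2 _ hM5 with h | h | h
          · exact absurd (h hL3) (Finset.notMem_erase s M)
          · refine hLM.antisymm fun a ha => ?_
            by_cases has : a = s
            · rwa [has]
            · exact h (Finset.mem_erase.2 ⟨has, ha⟩)
          · exfalso
            apply hL1
            refine Finset.eq_singleton_iff_unique_mem.2 ⟨hL3, fun a ha => ?_⟩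
            by_contra has
            exact Finset.disjoint_left.1 h ha (Finset.mem_erase.2 ⟨has, hLM ha⟩)
        rw [Finset.card_le_one]
        intro L hL M hM
        have hL' := hL
        have hM' := hM
        simp only [hF2, Finset.mem_erase, Finset.mem_filter] at hL' hM'
        rcases hlam L hL'.2.1 M hM'.2.1 with h | h | h
        · exact key L hL M hM h
        · exact (key M hM L hL h).symm
        · exact absurd hM'.2.2.1 (Finset.disjoint_left.1 h hL'.2.2.1)
      have h3 : F2.card ≤ 2 := by
        have := Finset.pred_card_le_card_erase (s := F2) (a := {s})
        omega
      have h4 : (F \ F2).card ≤ ((F.image (·.erase s)).erase ∅).card := by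
        refine Finset.card_le_card_of_injOn (·.erase s) ?_ ?_
        · intro L hL
          simp only [hF2, Finset.coe_sdiff, Set.mem_sdiff, Finset.mem_coe, Finset.mem_filter] at hL
          refine Finset.mem_coe.2 (Finset.mem_erase.2 ⟨fun h => ?_, Finset.mem_image_of_mem _ hL.1⟩)
          by_cases hsL : s ∈ L
          · exact hL.2 ⟨hL.1, hsL, Or.inl h⟩
          · dsimp only at h
            rw [Finset.erase_eq_of_notMem hsL] at h
            exact (hne L hL.1).ne_empty h
        · intro L hL M hM h
          simp only [hF2, Finset.coe_sdiff, Set.mem_sdiff, Finset.mem_coe,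
            Finset.mem_filter] at hL hM
          dsimp only at h
          by_cases hsL : s ∈ L <;> by_cases hsM : s ∈ M
          · rw [← Finset.insert_erase hsL, h, Finset.insert_erase hsM]
          · rw [Finset.erase_eq_of_notMem hsM] at h
            exact absurd ⟨hL.1, hsL, Or.inr (h ▸ hM.1)⟩ hL.2
          · rw [Finset.erase_eq_of_notMem hsL] at h
            exact absurd ⟨hM.1, hsM, Or.inr (h ▸ hL.1)⟩ hM.2
          · rwa [Finset.erase_eq_of_notMem hsL, Finset.erase_eq_of_notMem hsM] at h
      have h5 := Finset.card_sdiff_add_card_eq_card (hF2 ▸ Finset.filter_subset _ F : F2 ⊆ F)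
      rw [Finset.card_insert_of_notMem hs]
      omega
    · intro L hL
      obtain ⟨-, hL⟩ := Finset.mem_erase.1 hL
      obtain ⟨M, hM, rfl⟩ := Finset.mem_image.1 hL
      exact Finset.subset_insert_iff.1 (hsub M hM)
    · intro L hL
      exact Finset.nonempty_iff_ne_empty.2 (Finset.ne_of_mem_erase hL)
    · intro L hL M hM
      obtain ⟨L', hL', rfl⟩ := Finset.mem_image.1 (Finset.mem_of_mem_erase hL)
      obtain ⟨M', hM', rfl⟩ := Finset.mem_image.1 (Finset.mem_of_mem_erase hM)
      rcases hlam L' hL' M' hM' with h | h | h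
      · exact Or.inl (Finset.erase_subset_erase s h)
      · exact Or.inr (Or.inl (Finset.erase_subset_erase s h))
      · exact Or.inr (Or.inr (h.mono (Finset.erase_subset _ _) (Finset.erase_subset _ _)))

end Laminar

open scoped Classical in
/-- The set of marked nodes below `w` in a rooted tree. -/
noncomputable def below {N : Type*} (T : SimpleGraph N) (ρ : N) (S : Finset N) (w : N) :
    Finset N := S.filter (Anc T ρ w)

section Separate

variable {N : Type*} {T : SimpleGraph N} {ρ : N} {S : Finset N} {s w x y : N}

theorem mem_below : s ∈ below T ρ S w ↔ s ∈ S ∧ Anc T ρ w s := by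
  simp [below]

theorem below_anti (hT : T.IsTree) (h : Anc T ρ x y) : below T ρ S y ⊆ below T ρ S x := by
  intro s hs
  rw [mem_below] at hs ⊢
  exact ⟨hs.1, h.trans hT.connected hs.2⟩

theorem below_laminar (hT : T.IsTree) (x y : N) :
    below T ρ S x ⊆ below T ρ S y ∨ below T ρ S y ⊆ below T ρ S x ∨
      Disjoint (below T ρ S x) (below T ρ S y) := by
  by_cases h : Disjoint (below T ρ S x) (below T ρ S y)
  · exact Or.inr (Or.inr h)
  · obtain ⟨s, hx, hy⟩ := Finset.not_disjoint_iff.1 h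
    rcases (mem_below.1 hx).2.total hT (mem_below.1 hy).2 with h | h
    · exact Or.inr (Or.inl (below_anti hT h))
    · exact Or.inl (below_anti hT h)

/-- Among the nodes with a property that forces them to lie above a given node `s`, there is a
lowest one. -/
theorem exists_lowest [Finite N] (hT : T.IsTree) {P : N → Prop} (hP : ∃ w, P w)
    (hs : ∀ w, P w → Anc T ρ w s) : ∃ x, P x ∧ ∀ w, P w → Anc T ρ w x := by
  obtain ⟨x, hx, hmax⟩ := Set.exists_max_image {w | P w} (T.dist ρ) (Set.toFinite _) hP
  refine ⟨x, hx, fun w hw => ?_⟩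
  rcases (hs w hw).total hT (hs x hx) with h | h
  · exact h
  · rw [h.eq_of_dist_le hT.connected (hmax w hw)]
    exact Anc.refl _ _ _

/-- For every nonempty set `S` of marked nodes of a tree there are at most `2 * #S` pairs of nodes
such that every node `z` is separated from `S` by one of these pairs. If `L` is the set of marked
nodes below the lowest ancestor of `z` that has marked nodes below it, then the pair consists of the
lowest node above `L` and, unless `L = S`, the lowest node above `L` and a further marked node. -/
theorem exists_separating_pairs [Finite N] (hT : T.IsTree) (hS : S.Nonempty) :
    ∃ P : Finset (N × N), P.card ≤ 2 * S.card ∧ ∀ z, ∃ q ∈ P, ∀ s ∈ S, ∀ p : T.Walk z s,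
      q.1 ∈ p.support ∨ q.2 ∈ p.support := by
  classical
  have := Fintype.ofFinite N
  obtain ⟨ρ, hρ⟩ := hS
  let F := (Finset.univ.image (below T ρ S)).filter Finset.Nonempty
  have hFcard : F.card ≤ 2 * S.card := by
    refine card_le_of_laminar S F ?_ ?_ ?_
    · intro L hL
      obtain ⟨w, -, rfl⟩ := Finset.mem_image.1 (Finset.mem_filter.1 hL).1
      exact Finset.filter_subset _ _
    · intro L hL
      exact (Finset.mem_filter.1 hL).2
    · intro L hL M hM
      obtain ⟨w, -, rfl⟩ := Finset.mem_image.1 (Finset.mem_filter.1 hL).1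
      obtain ⟨w', -, rfl⟩ := Finset.mem_image.1 (Finset.mem_filter.1 hM).1
      exact below_laminar hT w w'
  have hx : ∀ L : Finset N, ∃ x, L ∈ F →
      below T ρ S x = L ∧ ∀ w, below T ρ S w = L → Anc T ρ w x := by
    intro L
    by_cases hL : L ∈ F
    · obtain ⟨h, s, hs⟩ := Finset.mem_filter.1 hL
      obtain ⟨w, -, hw⟩ := Finset.mem_image.1 h
      obtain ⟨x, hx⟩ := exists_lowest (P := fun w => below T ρ S w = L) hT ⟨w, hw⟩
        fun w hw => (mem_below.1 (hw ▸ hs)).2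
      exact ⟨x, fun _ => hx⟩
    · exact ⟨ρ, fun h => absurd h hL⟩
  have hy : ∀ L : Finset N, ∃ y, L ∈ F → (∃ w, L ⊂ below T ρ S w) →
      L ⊂ below T ρ S y ∧ ∀ w, L ⊂ below T ρ S w → Anc T ρ w y := by
    intro L
    by_cases hL : L ∈ F ∧ ∃ w, L ⊂ below T ρ S w
    · obtain ⟨h, s, hs⟩ := Finset.mem_filter.1 hL.1
      obtain ⟨y, hy⟩ := exists_lowest (P := fun w => L ⊂ below T ρ S w) hT hL.2
        fun w hw => (mem_below.1 (hw.1 hs)).2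
      exact ⟨y, fun _ _ => hy⟩
    · exact ⟨ρ, fun h h' => absurd ⟨h, h'⟩ hL⟩
  choose x hx using hx
  choose y hy using hy
  refine ⟨F.image fun L => (x L, y L), Finset.card_image_le.trans hFcard, fun z => ?_⟩
  obtain ⟨w, ⟨hwz, hwne⟩, hw⟩ := exists_lowest (ρ := ρ) (s := z)
    (P := fun w => Anc T ρ w z ∧ (below T ρ S w).Nonempty) hT
    ⟨ρ, Anc.root _ _ _, ρ, mem_below.2 ⟨hρ, Anc.refl _ _ _⟩⟩ fun w hw => hw.1
  set L := below T ρ S w with hLdef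
  have hL : L ∈ F := Finset.mem_filter.2 ⟨Finset.mem_image_of_mem _ (Finset.mem_univ _), hwne⟩
  refine ⟨(x L, y L), Finset.mem_image_of_mem _ hL, fun s hs p => ?_⟩
  obtain ⟨m, hmz, hms, hm⟩ := exists_anc_of_walk hT ρ p
  have hmw : Anc T ρ m w := hw m ⟨hmz, s, mem_below.2 ⟨hs, hms⟩⟩
  by_cases hsL : s ∈ L
  · left
    obtain ⟨h1, h2⟩ := hx L hL
    exact hm _ (hmw.trans hT.connected (h2 w rfl)) (Or.inr (mem_below.1 (h1 ▸ hsL)).2)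
  · right
    have hmL : L ⊂ below T ρ S m :=
      (Finset.ssubset_iff_of_subset (below_anti hT hmw)).2 ⟨s, mem_below.2 ⟨hs, hms⟩, hsL⟩
    obtain ⟨h1, h2⟩ := hy L hL ⟨m, hmL⟩
    refine hm _ (h2 m hmL) (Or.inl ?_)
    -- `y L` and `w` are both above the nonempty set `L`, and `y L` cannot be below `w`
    obtain ⟨a, ha⟩ := hwne
    rcases (mem_below.1 (h1.1 ha)).2.total hT (mem_below.1 ha).2 with h | h
    · exact h.trans hT.connected hwz
    · exact absurd (below_anti hT h) h1.2

end Separate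

/-! ### Connected sets of vertices in a tree representation -/

section Representation

variable {V : Type*} {G : SimpleGraph V}

theorem TreeRepresentation.ncard_bag_le [Fintype V] (R : TreeRepresentation G) {t : ℕ}
    (h : R.width ≤ t) (x : R.Node) : (R.bag x).ncard ≤ t + 1 := by
  have := R.finite_node
  have h1 : (R.bag x).ncard ≤ ⨆ x : R.Node, (R.bag x).ncard :=
    le_ciSup (f := fun x : R.Node => (R.bag x).ncard) (Set.finite_range _).bddAbove x
  unfold TreeRepresentation.width at h
  omega

theorem TreeRepresentation.exists_walk_model (R : TreeRepresentation G) {v : V} {x y : R.Node}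
    (hx : x ∈ (R.model v).verts) (hy : y ∈ (R.model v).verts) :
    ∃ q : R.tree.Walk x y, ∀ n ∈ q.support, n ∈ (R.model v).verts := by
  obtain ⟨p⟩ := (R.model_isTree v).connected ⟨x, hx⟩ ⟨y, hy⟩
  refine ⟨p.map (R.model v).hom, fun n hn => ?_⟩
  obtain ⟨a, -, rfl⟩ := List.mem_map.1 (Walk.support_map _ p ▸ hn)
  exact a.2

/-- A walk in `G` can be followed in the tree, inside the models of its vertices. -/
theorem TreeRepresentation.exists_walk_lift (R : TreeRepresentation G) {u v : V}
    (p : G.Walk u v) {x y : R.Node} (hx : x ∈ (R.model u).verts) (hy : y ∈ (R.model v).verts) :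
    ∃ q : R.tree.Walk x y, ∀ n ∈ q.support, ∃ c ∈ p.support, n ∈ (R.model c).verts := by
  induction p generalizing x with
  | nil =>
    obtain ⟨q, hq⟩ := R.exists_walk_model hx hy
    exact ⟨q, fun n hn => ⟨_, Walk.start_mem_support _, hq n hn⟩⟩
  | cons hadj p ih =>
    obtain ⟨m, hm1, hm2⟩ := R.model_inter _ _ hadj
    obtain ⟨q1, hq1⟩ := R.exists_walk_model hx hm1
    obtain ⟨q2, hq2⟩ := ih hm2 hy
    refine ⟨q1.append q2, fun n hn => ?_⟩
    rw [Walk.mem_support_append_iff] at hn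
    rcases hn with hn | hn
    · exact ⟨_, Walk.start_mem_support _, hq1 n hn⟩
    · obtain ⟨c, hc, hnc⟩ := hq2 n hn
      exact ⟨c, by simp [hc], hnc⟩

/-- The Helly property of subtrees, for unions of models: pairwise adjacent, pairwise disjoint
connected vertex sets all meet one common bag, so there are no more of them than vertices in a
bag. If the highest node of each union of models is considered, then the lowest one of these
belongs to all the unions. -/
theorem TreeRepresentation.card_le_of_pairwise_adj [Finite V] (R : TreeRepresentation G) {k : ℕ}
    (hbag : ∀ x, (R.bag x).ncard ≤ k) {ι : Type*} [Fintype ι] (C : ι → Set V)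
    (hne : ∀ i, (C i).Nonempty) (hdisj : ∀ i j u, u ∈ C i → u ∈ C j → i = j)
    (hconn : ∀ i, ∀ u ∈ C i, ∀ w ∈ C i, ∃ p : G.Walk u w, ∀ c ∈ p.support, c ∈ C i)
    (hadj : ∀ i j, i ≠ j → ∃ u ∈ C i, ∃ w ∈ C j, G.Adj u w) : Fintype.card ι ≤ k := by
  have := R.finite_node
  have hT := R.isTree
  obtain ⟨ρ⟩ := hT.connected.nonempty
  rcases isEmpty_or_nonempty ι with hι | hι
  · simp
  let H : ι → Set R.Node := fun i => {x | ∃ u ∈ C i, x ∈ (R.model u).verts}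
  have hHconn : ∀ i, ∀ x ∈ H i, ∀ y ∈ H i,
      ∃ q : R.tree.Walk x y, ∀ n ∈ q.support, n ∈ H i := by
    rintro i x ⟨u, hu, hx⟩ y ⟨w, hw, hy⟩
    obtain ⟨p, hp⟩ := hconn i u hu w hw
    obtain ⟨q, hq⟩ := R.exists_walk_lift p hx hy
    refine ⟨q, fun n hn => ?_⟩
    obtain ⟨c, hc, hnc⟩ := hq n hn
    exact ⟨c, hp c hc, hnc⟩
  have htop : ∀ i, ∃ x ∈ H i, ∀ y ∈ H i, R.tree.dist ρ x ≤ R.tree.dist ρ y := by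
    intro i
    refine Set.exists_min_image (H i) (R.tree.dist ρ) (Set.toFinite _) ?_
    obtain ⟨u, hu⟩ := hne i
    obtain ⟨x⟩ := (R.model_isTree u).connected.nonempty
    exact ⟨x, u, hu, x.2⟩
  choose a ha hamin using htop
  -- all nodes between a node of `H i` and the top `a i` belong to `H i`
  have hup : ∀ i, ∀ x ∈ H i, Anc R.tree ρ (a i) x ∧
      ∀ y, Anc R.tree ρ (a i) y → Anc R.tree ρ y x → y ∈ H i := by
    intro i x hx
    obtain ⟨q, hq⟩ := hHconn i x hx (a i) (ha i)
    obtain ⟨m, hmx, hma, hm⟩ := exists_anc_of_walk hT ρ q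
    have : m = a i := hma.eq_of_dist_le hT.connected
      (hamin i m (hq m (hm m (Anc.refl _ _ _) (Or.inl hmx))))
    subst this
    exact ⟨hmx, fun y h1 h2 => hq y (hm y h1 (Or.inl h2))⟩
  obtain ⟨j, hj⟩ := Finite.exists_max fun i => R.tree.dist ρ (a i)
  have hmem : ∀ i, a j ∈ H i := by
    intro i
    by_cases hij : i = j
    · subst hij; exact ha i
    obtain ⟨u, hu, w, hw, huw⟩ := hadj i j hij
    obtain ⟨x, hxu, hxw⟩ := R.model_inter u w huw
    obtain ⟨h1, h2⟩ := hup i x ⟨u, hu, hxu⟩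
    obtain ⟨h3, -⟩ := hup j x ⟨w, hw, hxw⟩
    refine h2 _ ?_ h3
    rcases h1.total hT h3 with h | h
    · exact h
    · rw [h.eq_of_dist_le hT.connected (hj i)]
      exact Anc.refl _ _ _
  choose f hfC hf using hmem
  have hinj : Function.Injective f := fun i i' h => hdisj i i' (f i) (hfC i) (h ▸ hfC i')
  calc Fintype.card ι = (Set.range f).ncard := by
        rw [← Nat.card_coe_set_eq, Nat.card_range_of_injective hinj, Nat.card_eq_fintype_card]
    _ ≤ (R.bag (a j)).ncard :=
        Set.ncard_le_ncard (by rintro _ ⟨i, rfl⟩; exact hf i) (Set.toFinite _)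
    _ ≤ k := hbag _

end Representation

/-! ### Balls in graphs of bounded treewidth have bounded Vapnik-Chervonenkis dimension -/

section Voronoi

variable {V : Type*} {G : SimpleGraph V}

theorem edist_add_edist_eq_of_mem_support {u v w : V} (p : G.Walk u v)
    (hp : (p.length : ℕ∞) = G.edist u v) (hw : w ∈ p.support) :
    G.edist u w + G.edist w v = G.edist u v := by
  refine le_antisymm ?_ G.edist_triangle
  rw [← hp]
  obtain ⟨q, r, rfl⟩ := Walk.mem_support_iff_exists_append.1 hw
  rw [Walk.length_append, Nat.cast_add]
  exact add_le_add (edist_le q) (edist_le r)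

variable {ι : Type*}

/-- The distance from `u` to the site `b i`, increased by the weight `c i` of the site. -/
noncomputable def weightedDist (G : SimpleGraph V) (b : ι → V) (c : ι → ℕ) (i : ι) (u : V) : ℕ∞ :=
  G.edist u (b i) + c i

variable {b : ι → V} {c : ι → ℕ} {i j : ι} {u v w : V}

theorem weightedDist_le_add (G : SimpleGraph V) (b : ι → V) (c : ι → ℕ) (i : ι) (u w : V) :
    weightedDist G b c i u ≤ G.edist u w + weightedDist G b c i w := by
  unfold weightedDist
  rw [← add_assoc]
  gcongr
  exact G.edist_triangle

/-- Along a shortest walk to `b i`, the weighted distance to `b i` decreases as fast as any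
weighted distance can. -/
theorem exists_walk_to_site (h : weightedDist G b c i u ≠ ⊤) :
    ∃ p : G.Walk u (b i), ∀ w ∈ p.support, G.edist u w ≠ ⊤ ∧
      weightedDist G b c i u = G.edist u w + weightedDist G b c i w := by
  have h1 : G.edist u (b i) ≠ ⊤ := fun h2 => h (by simp [weightedDist, h2])
  obtain ⟨p, hp⟩ := exists_walk_of_edist_ne_top h1
  refine ⟨p, fun w hw => ?_⟩
  have h2 := edist_add_edist_eq_of_mem_support p hp hw
  refine ⟨fun h3 => h1 (by rw [← h2, h3, top_add]), ?_⟩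
  unfold weightedDist
  rw [← add_assoc, h2]

variable [LinearOrder ι]

/-- The cell of the site `b i` in the additively weighted Voronoi diagram of the sites: all vertices
at finite distance for which `b i` is the closest site. Ties are broken by the order of `ι`, so
that the cells are disjoint. -/
def cell (G : SimpleGraph V) (b : ι → V) (c : ι → ℕ) (i : ι) : Set V :=
  {u | weightedDist G b c i u ≠ ⊤ ∧ ∀ l, l ≠ i → weightedDist G b c i u < weightedDist G b c l u ∨
    (weightedDist G b c i u = weightedDist G b c l u ∧ i < l)}

theorem eq_of_mem_cell (hi : u ∈ cell G b c i) (hj : u ∈ cell G b c j) : i = j := by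
  by_contra hij
  rcases hi.2 j (Ne.symm hij) with h | ⟨h, h'⟩ <;> rcases hj.2 i hij with h1 | ⟨h1, h1'⟩
  · exact lt_asymm h h1
  · exact h.ne h1.symm
  · exact h1.ne h.symm
  · exact lt_asymm h' h1'

theorem exists_walk_in_cell (hu : u ∈ cell G b c i) :
    ∃ p : G.Walk u (b i), ∀ w ∈ p.support, w ∈ cell G b c i := by
  obtain ⟨p, hp⟩ := exists_walk_to_site hu.1
  refine ⟨p, fun w hw => ?_⟩
  obtain ⟨h1, h2⟩ := hp w hw
  refine ⟨fun h3 => hu.1 (by rw [h2, h3, add_top]), fun l hl => ?_⟩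
  have h3 := weightedDist_le_add G b c l u w
  rcases hu.2 l hl with h | ⟨h, h'⟩
  · left
    have h4 := h.trans_le h3
    rw [h2] at h4
    exact lt_of_add_lt_add_left h4
  · rw [← h, h2, ENat.add_le_add_iff_left h1] at h3
    rcases h3.lt_or_eq with h4 | h4
    · exact Or.inl h4
    · exact Or.inr ⟨h4, h'⟩

theorem exists_walk_between_in_cell (hu : u ∈ cell G b c i) (hw : w ∈ cell G b c i) :
    ∃ p : G.Walk u w, ∀ a ∈ p.support, a ∈ cell G b c i := by
  obtain ⟨p, hp⟩ := exists_walk_in_cell hu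
  obtain ⟨q, hq⟩ := exists_walk_in_cell hw
  refine ⟨p.append q.reverse, fun a ha => ?_⟩
  rw [Walk.mem_support_append_iff, Walk.support_reverse, List.mem_reverse] at ha
  exact ha.elim (hp a) (hq a)

theorem mem_cell_or_mem_cell (hij : i ≠ j) (hj : weightedDist G b c j w ≠ ⊤)
    (h : ∀ l, l ≠ i → l ≠ j → weightedDist G b c j w < weightedDist G b c l w) :
    w ∈ cell G b c i ∨ w ∈ cell G b c j := by
  by_cases hlt : weightedDist G b c i w < weightedDist G b c j w ∨
      (weightedDist G b c i w = weightedDist G b c j w ∧ i < j)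
  · left
    have hle : weightedDist G b c i w ≤ weightedDist G b c j w := hlt.elim le_of_lt (·.1.le)
    refine ⟨ne_top_of_le_ne_top hj hle, fun l hl => ?_⟩
    by_cases hlj : l = j
    · subst hlj; exact hlt
    · exact Or.inl (hle.trans_lt (h l hl hlj))
  · right
    refine ⟨hj, fun l hl => ?_⟩
    by_cases hli : l = i
    · subst hli
      push Not at hlt
      rcases hlt.1.lt_or_eq with h1 | h1
      · exact Or.inl h1
      · exact Or.inr ⟨h1, lt_of_le_of_ne (hlt.2 h1.symm) (Ne.symm hl)⟩
    · exact Or.inl (h l hli hl)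

/-- If `v` lies in the cell of `b i`, and `b i` and `b j` are the only sites at weighted distance at
most `r` from `v`, then a shortest walk from `v` to `b j` meets no cells but those of `b i` and
`b j`, and therefore an edge joins the two cells. -/
theorem exists_adj_between_cells (hij : i ≠ j) {r : ℕ} (hi : v ∈ cell G b c i)
    (hjne : (cell G b c j).Nonempty) (hj : weightedDist G b c j v ≤ r)
    (h : ∀ l, l ≠ i → l ≠ j → ¬ weightedDist G b c l v ≤ r) :
    ∃ u ∈ cell G b c i, ∃ w ∈ cell G b c j, G.Adj u w := by
  obtain ⟨p, hp⟩ := exists_walk_to_site (ne_top_of_le_ne_top (ENat.natCast_ne_top r) hj)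
  have hsupp : ∀ w ∈ p.support, w ∈ cell G b c i ∨ w ∈ cell G b c j := by
    intro w hw
    obtain ⟨h1, h2⟩ := hp w hw
    rw [h2] at hj
    refine mem_cell_or_mem_cell hij
      (ne_top_of_le_ne_top (ENat.natCast_ne_top r) (le_add_self.trans hj)) fun l hli hlj => ?_
    have h3 := (hj.trans_lt (not_le.1 (h l hli hlj))).trans_le (weightedDist_le_add G b c l v w)
    exact lt_of_add_lt_add_left h3
  have hbj : b j ∈ cell G b c j := by
    obtain ⟨u, hu⟩ := hjne
    obtain ⟨q, hq⟩ := exists_walk_in_cell hu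
    exact hq _ q.end_mem_support
  obtain ⟨d, hd, hd1, hd2⟩ := p.exists_boundary_dart (cell G b c i) hi
    fun h => hij (eq_of_mem_cell h hbj)
  exact ⟨d.fst, hd1, d.snd, (hsupp _ (p.dart_snd_mem_support_of_mem_darts hd)).resolve_left hd2,
    d.adj⟩

/-- If the vertices of `G` realize every subset of a set of balls, then the Voronoi cells of the
centers form a complete minor, so that there are at most as many balls as vertices in a bag. -/
theorem TreeRepresentation.card_le_of_realized [Finite V] (R : TreeRepresentation G) {k : ℕ}
    (hbag : ∀ x, (R.bag x).ncard ≤ k) [Fintype ι] (b : ι → V) (c : ι → ℕ) (r : ℕ)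
    (h : ∀ J : Set ι, ∃ v, ∀ i, weightedDist G b c i v ≤ r ↔ i ∈ J) : Fintype.card ι ≤ k := by
  have hne : ∀ i, (cell G b c i).Nonempty := by
    intro i
    obtain ⟨v, hv⟩ := h {i}
    have hi := (hv i).2 rfl
    refine ⟨v, ne_top_of_le_ne_top (ENat.natCast_ne_top r) hi, fun l hl => Or.inl ?_⟩
    exact hi.trans_lt (not_le.1 fun h => hl ((hv l).1 h))
  refine R.card_le_of_pairwise_adj hbag (cell G b c) hne (fun i j u => eq_of_mem_cell)
    (fun i u hu w hw => exists_walk_between_in_cell hu hw) fun i j hij => ?_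
  obtain ⟨v, hv⟩ := h {i, j}
  have hi := (hv i).2 (by simp)
  have hj := (hv j).2 (by simp)
  have hl : ∀ l, l ≠ i → l ≠ j → ¬ weightedDist G b c l v ≤ r := fun l hli hlj h => by
    simpa [hli, hlj] using (hv l).1 h
  rcases mem_cell_or_mem_cell (w := v) hij (ne_top_of_le_ne_top (ENat.natCast_ne_top r) hj)
    fun l hli hlj => hj.trans_lt (not_le.1 (hl l hli hlj)) with hv | hv
  · exact exists_adj_between_cells hij hv (hne j) hj hl
  · obtain ⟨u, hu, w, hw, huw⟩ := exists_adj_between_cells hij.symm hv (hne i) hi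
      fun l hlj hli => hl l hli hlj
    exact ⟨w, hw, u, hu, huw.symm⟩

end Voronoi

/-! ### Counting profiles -/

section Counting

theorem sum_choose_le {n : ℕ} (hn : 2 ≤ n) (d : ℕ) :
    ∑ k ∈ Finset.Iic d, n.choose k ≤ 2 * n ^ d := by
  have h : ∀ d, Finset.Iic d = Finset.range (d + 1) := fun d => by ext; simp
  rw [h]
  induction d with
  | zero => simp
  | succ d ih =>
    rw [Finset.sum_range_succ]
    have h1 := Nat.choose_le_pow n (d + 1)
    have h2 : 2 * n ^ d ≤ n ^ (d + 1) := by rw [pow_succ']; gcongr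
    omega

variable {V : Type*} {G : SimpleGraph V}

open scoped Classical in
/-- The pairs `(b, i)` with `b ∈ B` and `i ≤ r` such that the ball of radius `i` around `b`
contains `v`. These encode the `r`-profile of `v` with respect to `B` as a set. -/
noncomputable def ballSet (G : SimpleGraph V) (r : ℕ) (B : Finset V) (v : V) :
    Finset (B × Fin (r + 1)) :=
  Finset.univ.filter fun q => G.edist v q.1 ≤ (q.2 : ℕ)

theorem mem_ballSet {r : ℕ} {B : Finset V} {v : V} {q : B × Fin (r + 1)} :
    q ∈ ballSet G r B v ↔ G.edist v q.1 ≤ (q.2 : ℕ) := by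
  simp [ballSet]

open scoped Classical in
theorem TreeRepresentation.card_le_of_shatters [Fintype V] (R : TreeRepresentation G) {k r : ℕ}
    (hbag : ∀ x, (R.bag x).ncard ≤ k) (B : Finset V) {s : Finset (B × Fin (r + 1))}
    (hs : (Finset.univ.image (ballSet G r B)).Shatters s) : s.card ≤ k := by
  let e := s.equivFin.symm
  have h := R.card_le_of_realized hbag (fun i : Fin s.card => ((e i).1.1 : V))
    (fun i => r - (e i).1.2) r ?_
  · simpa using h
  intro J
  obtain ⟨u, hu, hsu⟩ := @hs (s.filter fun q => ∃ i ∈ J, (e i).1 = q) (Finset.filter_subset _ _)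
  obtain ⟨v, -, rfl⟩ := Finset.mem_image.1 hu
  refine ⟨v, fun i => ?_⟩
  have h1 : weightedDist G (fun i : Fin s.card => ((e i).1.1 : V)) (fun i => r - (e i).1.2) i v
      ≤ r ↔ (e i).1 ∈ ballSet G r B v := by
    rw [mem_ballSet, weightedDist]
    have h2 : (r : ℕ∞) = ((e i).1.2 : ℕ) + ((r - (e i).1.2 : ℕ) : ℕ∞) := by
      rw [← Nat.cast_add]
      congr 1
      have := (e i).1.2.2
      omega
    conv_lhs => rw [h2]
    exact ENat.add_le_add_iff_right (ENat.natCast_ne_top _)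
  rw [h1]
  have h3 := Finset.ext_iff.1 hsu (e i).1
  simp only [Finset.mem_inter, Finset.mem_filter, (e i).2, true_and] at h3
  rw [h3]
  constructor
  · rintro ⟨i', hi', h⟩
    rwa [← e.injective (Subtype.ext h)]
  · exact fun hi => ⟨i, hi, rfl⟩

open scoped Classical in
/-- The Sauer-Shelah bound on the number of `r`-profiles with respect to `B`. -/
theorem TreeRepresentation.card_image_ballSet_le [Fintype V] (R : TreeRepresentation G) {k r n : ℕ}
    (hbag : ∀ x, (R.bag x).ncard ≤ k) (B : Finset V) (hn : 2 ≤ n)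
    (hB : B.card * (r + 1) ≤ n) :
    (Finset.univ.image (ballSet G r B)).card ≤ 2 * n ^ k := by
  have hvc : (Finset.univ.image (ballSet G r B)).vcDim ≤ k :=
    Finset.sup_le fun s hs => R.card_le_of_shatters hbag B (Finset.mem_shatterer.1 hs)
  refine (Finset.card_le_card_shatterer _).trans
    (Finset.card_shatterer_le_sum_vcDim.trans (le_trans ?_ (sum_choose_le hn k)))
  refine (Finset.sum_le_sum_of_subset (Finset.Iic_subset_Iic.2 hvc)).trans
    (Finset.sum_le_sum fun i _ => Nat.choose_le_choose i ?_)
  simpa using hB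

/-- If every walk from `v` or `v'` to `a` meets `B`, and `v` and `v'` have the same distances up to
`r` to `B`, then they have the same distances up to `r` to `a`. -/
theorem cap_edist_eq {r : ℕ} {B : Finset V} {v v' a : V}
    (hv : ∀ p : G.Walk v a, ∃ b ∈ p.support, b ∈ B)
    (hv' : ∀ p : G.Walk v' a, ∃ b ∈ p.support, b ∈ B)
    (h : ballSet G r B v = ballSet G r B v') : cap r (G.edist a v) = cap r (G.edist a v') := by
  have key : ∀ x y : V, (∀ p : G.Walk x a, ∃ b ∈ p.support, b ∈ B) →
      ballSet G r B x = ballSet G r B y → G.edist x a ≤ r → G.edist y a ≤ G.edist x a := by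
    intro x y hx hxy hr
    obtain ⟨p, hp⟩ := exists_walk_of_edist_ne_top (ne_top_of_le_ne_top (ENat.natCast_ne_top r) hr)
    obtain ⟨b, hb, hbB⟩ := hx p
    have h1 := edist_add_edist_eq_of_mem_support p hp hb
    have h2 : G.edist x b ≤ r := (le_self_add.trans h1.le).trans hr
    obtain ⟨d, hd⟩ := ENat.ne_top_iff_exists.1 (ne_top_of_le_ne_top (ENat.natCast_ne_top r) h2)
    have hdr : d ≤ r := by rw [← hd] at h2; exact_mod_cast h2
    have h3 : ((⟨b, hbB⟩, ⟨d, Nat.lt_succ_of_le hdr⟩) : B × Fin (r + 1)) ∈ ballSet G r B x :=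
      mem_ballSet.2 hd.ge
    rw [hxy, mem_ballSet] at h3
    rw [← h1, ← hd]
    exact G.edist_triangle.trans (add_le_add_left h3 _)
  rw [G.edist_comm (u := a), G.edist_comm (u := a)]
  unfold cap
  by_cases h1 : G.edist v a ≤ r
  · have h2 := key v v' hv h h1
    rw [if_pos h1, if_pos (h2.trans h1)]
    exact (key v' v hv' h.symm (h2.trans h1)).antisymm h2
  · rw [if_neg h1, if_neg fun h2 => h1 ((key v' v hv' h.symm h2).trans h2)]

/-- In a tree representation with bags of size at most `k`, a nonempty set `A` of vertices gives
rise to at most `2 * #A` sets `B` of size at most `2 * k` such that every vertex is separated from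
`A` by one of them. -/
theorem TreeRepresentation.exists_separators [Fintype V] (R : TreeRepresentation G) {k : ℕ}
    (hbag : ∀ x, (R.bag x).ncard ≤ k) {A : Finset V} (hA : A.Nonempty) :
    ∃ F : Finset (Finset V), F.card ≤ 2 * A.card ∧ (∀ B ∈ F, B.card ≤ 2 * k) ∧
      ∀ v, ∃ B ∈ F, ∀ a ∈ A, ∀ p : G.Walk v a, ∃ b ∈ p.support, b ∈ B := by
  classical
  have := R.finite_node
  have hx : ∀ v, ∃ x, x ∈ (R.model v).verts := fun v => by
    obtain ⟨x⟩ := (R.model_isTree v).connected.nonempty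
    exact ⟨x, x.2⟩
  choose x hx using hx
  obtain ⟨P, hP, hsep⟩ := exists_separating_pairs R.isTree (hA.image x)
  let B : R.Node × R.Node → Finset V := fun q =>
    (R.bag q.1).toFinite.toFinset ∪ (R.bag q.2).toFinite.toFinset
  refine ⟨P.image B, ?_, ?_, fun v => ?_⟩
  · exact Finset.card_image_le.trans (hP.trans (Nat.mul_le_mul_left _ Finset.card_image_le))
  · intro C hC
    obtain ⟨q, -, rfl⟩ := Finset.mem_image.1 hC
    refine (Finset.card_union_le _ _).trans ?_
    rw [← Set.ncard_eq_toFinset_card, ← Set.ncard_eq_toFinset_card]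
    have := hbag q.1
    have := hbag q.2
    omega
  · obtain ⟨q, hq, h⟩ := hsep (x v)
    refine ⟨B q, Finset.mem_image_of_mem _ hq, fun a ha p => ?_⟩
    obtain ⟨p', hp'⟩ := R.exists_walk_lift p (hx v) (hx a)
    rcases h (x a) (Finset.mem_image_of_mem _ ha) p' with h1 | h1
    · obtain ⟨b, hb, hb'⟩ := hp' _ h1
      exact ⟨b, hb, Finset.mem_union_left _ ((Set.Finite.mem_toFinset _).2 hb')⟩
    · obtain ⟨b, hb, hb'⟩ := hp' _ h1
      exact ⟨b, hb, Finset.mem_union_right _ ((Set.Finite.mem_toFinset _).2 hb')⟩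

/-- If the sets `{v | p B v}` with `B ∈ F` cover the domain of `f`, and on each of them `f` is
determined by a function `g B` with at most `n` values, then `f` has at most `#F * n` values. -/
theorem card_image_le_of_cover {α β γ : Type*} {δ : γ → Type*} [Fintype α]
    [DecidableEq β] [∀ B, DecidableEq (δ B)] (f : α → β)
    (F : Finset γ) (p : γ → α → Prop) (g : ∀ B, α → δ B) (n : ℕ)
    (hcover : ∀ v, ∃ B ∈ F, p B v) (hg : ∀ B ∈ F, (Finset.univ.image (g B)).card ≤ n)
    (hf : ∀ B ∈ F, ∀ v v', p B v → p B v' → g B v = g B v' → f v = f v') :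
    (Finset.univ.image f).card ≤ F.card * n := by
  classical
  have h1 : Finset.univ.image f ⊆ F.biUnion fun B => (Finset.univ.filter (p B)).image f := by
    intro y hy
    obtain ⟨v, -, rfl⟩ := Finset.mem_image.1 hy
    obtain ⟨B, hB, hv⟩ := hcover v
    exact Finset.mem_biUnion.2 ⟨B, hB, Finset.mem_image_of_mem _ (by simpa using hv)⟩
  refine (Finset.card_le_card h1).trans (Finset.card_biUnion_le_card_mul _ _ _ fun B hB => ?_)
  refine le_trans ?_ (hg B hB)
  refine Finset.card_le_card_of_forall_subsingleton
    (fun y z => ∃ v, p B v ∧ f v = y ∧ g B v = z) ?_ ?_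
  · intro y hy
    obtain ⟨v, hv, rfl⟩ := Finset.mem_image.1 hy
    exact ⟨g B v, Finset.mem_image_of_mem _ (Finset.mem_univ _), v, (Finset.mem_filter.1 hv).2,
      rfl, rfl⟩
  · rintro z - y ⟨-, v, hv, rfl, h2⟩ y' ⟨-, v', hv', rfl, h2'⟩
    exact hf B hB v v' hv hv' (h2.trans h2'.symm)

end Counting

/-! ### The bounds on the profile complexity -/

theorem pcOn_le_of_treewidth_le {V : Type u} [Fintype V] (G : SimpleGraph V) (t r : ℕ)
    (h : treewidth G ≤ (t : ℤ)) (A : Finset V) :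
    pcOn G r A ≤ 2 ^ (t + 3) * (r + 1) ^ (t + 1) * (t + 1) ^ (t + 1) * A.card := by
  classical
  rcases A.eq_empty_or_nonempty with rfl | hA
  · -- there is only one profile with respect to the empty set, and it is constantly `⊤`
    have : Set.range (profile G r ∅) \ {fun _ => ⊤} = ∅ := by
      rw [Set.sdiff_eq_empty]
      rintro f -
      exact Subsingleton.elim _ _
    simp [pcOn, this]
  obtain ⟨R, hR⟩ := exists_width_eq_treewidth G
  have hbag := R.ncard_bag_le (hR.le.trans h)
  obtain ⟨F, hF, hFk, hsep⟩ := R.exists_separators hbag hA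
  have hn : 2 ≤ 2 * (t + 1) * (r + 1) := by nlinarith [Nat.zero_le (t * r)]
  have h1 := card_image_le_of_cover (profile G r A) F
    (fun B v => ∀ a ∈ A, ∀ p : G.Walk v a, ∃ b ∈ p.support, b ∈ B) (fun B => ballSet G r B)
    (2 * (2 * (t + 1) * (r + 1)) ^ (t + 1)) hsep
    (fun B hB => R.card_image_ballSet_le hbag B hn (Nat.mul_le_mul_right _ (hFk B hB)))
    (fun B _ v v' hv hv' hvv' => funext fun a =>
      cap_edist_eq (hv a a.2) (hv' a a.2) hvv')
  calc pcOn G r A ≤ (Set.range (profile G r A)).ncard :=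
        Set.ncard_le_ncard Set.sdiff_subset (Set.toFinite _)
    _ = (Finset.univ.image (profile G r A)).card := by
        rw [← Set.ncard_coe_finset, Finset.coe_image, Finset.coe_univ, Set.image_univ]
    _ ≤ F.card * (2 * (2 * (t + 1) * (r + 1)) ^ (t + 1)) := h1
    _ ≤ 2 * A.card * (2 * (2 * (t + 1) * (r + 1)) ^ (t + 1)) := Nat.mul_le_mul_right _ hF
    _ = 2 ^ (t + 3) * (r + 1) ^ (t + 1) * (t + 1) ^ (t + 1) * A.card := by
        rw [mul_pow, mul_pow]; ring

/-- The exponent of `t` is not optimized. The factor `256` is forced by `t = r = 1`, and for `t ≥ 2`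
the powers of `2` and of `t + 1` are bounded by powers of `t`. -/
theorem two_pow_mul_pow_le {t r : ℕ} (ht : 0 < t) (hr : 0 < r) :
    2 ^ (t + 3) * (r + 1) ^ (t + 1) * (t + 1) ^ (t + 1) ≤ 256 * t ^ (6 * t) * r ^ (t + 1) := by
  have h1 : (r + 1) ^ (t + 1) ≤ 2 ^ (t + 1) * r ^ (t + 1) := by
    rw [← mul_pow]
    exact Nat.pow_le_pow_left (by omega) _
  have h2 : 2 ^ (t + 3) * 2 ^ (t + 1) * (t + 1) ^ (t + 1) ≤ 256 * t ^ (6 * t) := by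
    obtain rfl | ht2 : t = 1 ∨ 2 ≤ t := by omega
    · norm_num
    calc 2 ^ (t + 3) * 2 ^ (t + 1) * (t + 1) ^ (t + 1)
        = 16 * 2 ^ (2 * t) * (t + 1) ^ (t + 1) := by ring
      _ ≤ 256 * t ^ (2 * t) * (t ^ 2) ^ (t + 1) := by
          gcongr
          · norm_num
          · nlinarith
      _ = 256 * t ^ (2 * t + 2 * (t + 1)) := by rw [← pow_mul, mul_assoc, ← pow_add]
      _ ≤ 256 * t ^ (6 * t) := by
          gcongr; omega
  calc 2 ^ (t + 3) * (r + 1) ^ (t + 1) * (t + 1) ^ (t + 1)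
      ≤ 2 ^ (t + 3) * (2 ^ (t + 1) * r ^ (t + 1)) * (t + 1) ^ (t + 1) := by gcongr
    _ = 2 ^ (t + 3) * 2 ^ (t + 1) * (t + 1) ^ (t + 1) * r ^ (t + 1) := by ring
    _ ≤ _ := by gcongr

end ProfileComplexity

theorem mainTheorem1 :
    (∀ (V : Type u) [Fintype V] (G : SimpleGraph V) (t r : ℕ),
      ProfileComplexity.treewidth G ≤ (t : ℤ) →
      ∀ A : Finset V, ProfileComplexity.pcOn G r A ≤
        2 ^ (t + 3) * (r + 1) ^ (t + 1) * (t + 1) ^ (t + 1) * A.card) ∧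
    (∃ c C : ℕ, ∀ (V : Type u) [Fintype V] (G : SimpleGraph V) (t r : ℕ), 0 < t → 0 < r →
      ProfileComplexity.treewidth G ≤ (t : ℤ) →
      ∀ k : ℕ, ProfileComplexity.pc G r k ≤ C * t ^ (c * t) * r ^ (t + 1) * k) := by
  refine ⟨fun V _ G t r h A => ProfileComplexity.pcOn_le_of_treewidth_le G t r h A, 6, 256,
    fun V _ G t r ht hr h k => Finset.sup_le fun A hA => ?_⟩
  rw [← (Finset.mem_powersetCard.1 hA).2]
  exact (ProfileComplexity.pcOn_le_of_treewidth_le G t r h A).trans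
    (Nat.mul_le_mul_right _ (ProfileComplexity.two_pow_mul_pow_le ht hr))
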